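/- All logarithms $\log$ are to the base $2$. For a positive integer $d$, the hypercube $Q_d$ is the graph whose vertices are the $d$-bit binary strings, two strings being adjacent if and only if they differ at exactly one position. A permutation of a finite set $V$ is a bijection $V\to\{1,\dots,|V|\}$; it separates two disjoint sets $A,B\subseteq V$ if every element of one of them precedes every element of the other. The separation dimension $\pi(G)$ of a finite graph $G$ is the cardinality of a smallest family $\mathcal F$ of permutations of $V(G)$ such that every two disjoint edges of $G$ are separated by some member of $\mathcal F$. **Theorem.** For every integer $d\ge 3$, $$\pi(Q_d)\ \ge\ \tfrac12\,\bigl\lfloor \log\log(d-1)\bigr\rfloor ,$$ and there is a function $\varepsilon:\mathbb N\to\mathbb R$ with $\varepsilon(d)\to 0$ as $d\to\infty$ such that, for every integer $d\ge 3$, $$\pi(Q_d)\ \le\ \Bigl\lceil \log\log d+\tfrac12\log\log\log d+\log\sqrt{2\pi}+\varepsilon(d)\Bigr\rceil ,$$ where $\pi$ under the square root is the circle constant. -/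

import Mathlib

open Filter Topology

/-- A permutation of a finite set `V`: a bijection from `V` to `[|V|]`. -/
abbrev VertexPerm (V : Type*) [Fintype V] : Type _ :=
  V ≃ Fin (Fintype.card V)

/-- Every element of `A` precedes every element of `B` in `σ`. -/
def Precedes {V : Type*} [Fintype V] (σ : VertexPerm V) (A B : Finset V) : Prop :=
  ∀ a ∈ A, ∀ b ∈ B, σ a < σ b

/-- `σ` separates `A` and `B`. -/
def Separates {V : Type*} [Fintype V] (σ : VertexPerm V) (A B : Finset V) : Prop :=
  Precedes σ A B ∨ Precedes σ B A

/-- The family `F` is pairwise suitable for the hypergraph with vertex set `V` and edge set `E`: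
any two disjoint edges are separated by some member of `F`. -/
def IsPairwiseSuitable {V : Type*} [Fintype V]
    (F : Finset (VertexPerm V)) (E : Set (Finset V)) : Prop :=
  ∀ e ∈ E, ∀ f ∈ E, e ≠ f → Disjoint e f → ∃ σ ∈ F, Separates σ e f

/-- The separation dimension of the hypergraph with vertex set `V` and edge set `E`: the cardinality
of a smallest family of permutations of `V` that is pairwise suitable for it. -/
noncomputable def separationDimension {V : Type*} [Fintype V] (E : Set (Finset V)) : ℕ :=
  sInf {k : ℕ | ∃ F : Finset (VertexPerm V), IsPairwiseSuitable F E ∧ F.card = k}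

/-- The edges of a graph as two-element sets of vertices, i.e. the graph as a `2`-uniform
hypergraph. -/
def graphEdges {V : Type*} [DecidableEq V] (G : SimpleGraph V) : Set (Finset V) :=
  {e | ∃ u v : V, G.Adj u v ∧ e = {u, v}}

/-- The `d`-dimensional hypercube: binary strings of length `d`, two of them adjacent when they
differ at exactly one position. -/
def hypercube (d : ℕ) : SimpleGraph (Fin d → Bool) where
  Adj u v := ∃! i, u i ≠ v i
  symm := ⟨fun _ _ ⟨i, hi, h⟩ => ⟨i, hi.symm, fun j hj => h j hj.symm⟩⟩
  loopless := ⟨fun _ ⟨_, hi, _⟩ => hi rfl⟩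

/-! Lower bound: given `k` permutations, iterated Erdős–Szekeres on the strings of weight one leaves
many positions along which every permutation is monotone, and after reversals increasing. Separating
suitable edges between weights one and two then forces a shift colouring with `2 ^ k` colours, which
bounds the number of positions left.

Upper bound: two disjoint edges in directions `i`, `j` differ at some position `l` other than `i`,
`j`. A lexicographic order that reads `l` before `i` and `j` separates them, so it suffices to have
few orders of the positions in which each `l` somewhere precedes any given `i`, `j`. Spencer's
construction gives `m + 1` of them when `d ≤ 2 ^ m.choose r` and `2 * r < m`. Wallis's product
estimates the binomial coefficient near the middle. -/

/-! ### Monotone subsequences and shift colourings. -/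

/-- If chains of `r` along `<` in `S` have at most `m` elements, then `S` can be labelled
by numbers below `m`, increasingly along `r`. -/
theorem exists_label_of_card_chain_le (S : Finset ℕ) (r : ℕ → ℕ → Prop)
    (htr : ∀ x y z, r x y → r y z → r x z) (m : ℕ)
    (h : ∀ T ⊆ S, (∀ x ∈ T, ∀ y ∈ T, x < y → r x y) → T.card ≤ m) :
    ∃ l : ℕ → ℕ, (∀ x ∈ S, l x < m) ∧ ∀ x ∈ S, ∀ y ∈ S, x < y → r x y → l x < l y := by
  classical
  -- The label is the size of a longest chain strictly below `x`; leaving out `x` itself keeps it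
  -- below `m`.
  let C : ℕ → Finset (Finset ℕ) := fun x => S.powerset.filter fun T =>
    (∀ y ∈ T, y < x ∧ r y x) ∧ ∀ y ∈ T, ∀ z ∈ T, y < z → r y z
  have hC : ∀ x ∈ S, ∀ T ∈ C x, insert x T ⊆ S ∧ (insert x T).card = T.card + 1 ∧
      ∀ y ∈ insert x T, ∀ z ∈ insert x T, y < z → r y z := by
    intro x hx T hT
    obtain ⟨hTS, hTx, hTc⟩ := by simpa [C] using hT
    refine ⟨Finset.insert_subset hx hTS, Finset.card_insert_of_notMem fun hxT =>
      lt_irrefl _ (hTx x hxT).1, ?_⟩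
    intro y hy z hz hyz
    rcases Finset.mem_insert.1 hy with hy' | hy' <;> rcases Finset.mem_insert.1 hz with hz' | hz'
    · omega
    · have := (hTx z hz').1
      omega
    · rw [hz']
      exact (hTx y hy').2
    · exact hTc y hy' z hz' hyz
  have hne : ∀ x, (C x).Nonempty := fun x => ⟨∅, by simp [C]⟩
  refine ⟨fun x => (C x).sup Finset.card, fun x hx => ?_, fun x hx y hy hxy hr => ?_⟩
  · obtain ⟨T, hT, hTe⟩ := Finset.exists_mem_eq_sup (C x) (hne x) Finset.card
    obtain ⟨h1, h2, h3⟩ := hC x hx T hT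
    have := h _ h1 h3
    simp only [hTe]
    omega
  · obtain ⟨T, hT, hTe⟩ := Finset.exists_mem_eq_sup (C x) (hne x) Finset.card
    obtain ⟨h1, h2, h3⟩ := hC x hx T hT
    have hmem : insert x T ∈ C y := by
      simp only [C, Finset.mem_filter, Finset.mem_powerset]
      refine ⟨h1, fun z hz => ?_, h3⟩
      rcases Finset.mem_insert.1 hz with rfl | hz
      · exact ⟨hxy, hr⟩
      · have := (Finset.mem_filter.1 hT).2.1 z hz
        exact ⟨this.1.trans hxy, htr _ _ _ this.2 hr⟩
    have := Finset.le_sup (f := Finset.card) hmem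
    simp only [hTe]
    omega

/-- The Erdős–Szekeres theorem. -/
theorem erdos_szekeres_card {S : Finset ℕ} {f : ℕ → ℤ} (hf : Set.InjOn f S) {m : ℕ}
    (hm : m ^ 2 < S.card) :
    ∃ T ⊆ S, m < T.card ∧ (StrictMonoOn f T ∨ StrictAntiOn f T) := by
  by_contra! hcon
  obtain ⟨l₁, h₁, h₁'⟩ := exists_label_of_card_chain_le S (fun x y => f x < f y)
    (fun _ _ _ => lt_trans) m (fun T hT hc => by
      by_contra! hlt
      exact (hcon T hT hlt).1 fun x hx y hy hxy => hc x hx y hy hxy)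
  obtain ⟨l₂, h₂, h₂'⟩ := exists_label_of_card_chain_le S (fun x y => f y < f x)
    (fun _ _ _ h h' => lt_trans h' h) m (fun T hT hc => by
      by_contra! hlt
      exact (hcon T hT hlt).2 fun x hx y hy hxy => hc x hx y hy hxy)
  have hinj : ∀ x ∈ S, ∀ y ∈ S, x < y → (l₁ x, l₂ x) ≠ (l₁ y, l₂ y) := by
    intro x hx y hy hxy he
    rw [Prod.mk.injEq] at he
    rcases lt_trichotomy (f x) (f y) with h | h | h
    · have := h₁' x hx y hy hxy h
      omega
    · exact hxy.ne (hf hx hy h)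
    · have := h₂' x hx y hy hxy h
      omega
  have hcard : S.card ≤ (Finset.range m ×ˢ Finset.range m).card := by
    refine Finset.card_le_card_of_injOn (fun x => (l₁ x, l₂ x))
      (fun x hx => by simpa using ⟨h₁ x hx, h₂ x hx⟩) ?_
    intro x hx y hy he
    rcases lt_trichotomy x y with h | h | h
    · exact absurd he (hinj x hx y hy h)
    · exact h
    · exact absurd he.symm (hinj y hy x hx h)
  rw [Finset.card_product, Finset.card_range] at hcard
  nlinarith

/-- Each use of Erdős–Szekeres takes a square root of the size bound, which lowers the upper
exponent by one. -/
theorem exists_common_monotone {ι : Type*} (s : Finset ι) (f : ι → ℕ → ℤ) (t : ℕ) :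
    ∀ S : Finset ℕ, (∀ p ∈ s, Set.InjOn (f p) S) → 2 ^ 2 ^ (s.card + t) < S.card →
    ∃ T ⊆ S, 2 ^ 2 ^ t < T.card ∧ ∀ p ∈ s, StrictMonoOn (f p) T ∨ StrictAntiOn (f p) T := by
  classical
  induction s using Finset.induction_on with
  | empty => intro S _ h; exact ⟨S, subset_rfl, by simpa using h, by simp⟩
  | insert p s hp ih =>
    intro S hS h
    rw [Finset.card_insert_of_notMem hp, add_right_comm, pow_succ, pow_mul] at h
    obtain ⟨T, hTS, hT, hmono⟩ := erdos_szekeres_card (hS p (Finset.mem_insert_self _ _)) h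
    obtain ⟨U, hUT, hU, hU'⟩ := ih T
      (fun q hq => (hS q (Finset.mem_insert_of_mem hq)).mono (by exact_mod_cast hTS)) hT
    refine ⟨U, hUT.trans hTS, hU, fun q hq => ?_⟩
    rcases Finset.mem_insert.1 hq with rfl | hq
    · exact hmono.imp (fun h => h.mono (by exact_mod_cast hUT))
        (fun h => h.mono (by exact_mod_cast hUT))
    · exact hU' q hq

/-- The shift colouring bound: if `R i j ≠ R j k` for `i < j < k`, then the number of
indices is at most exponential in the number of colours. -/
theorem card_le_of_shift_coloring {α : Type*} [Fintype α] (n : ℕ) (R : ℕ → ℕ → α)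
    (hR : ∀ i j k, i < j → j < k → k < n → R i j ≠ R j k) :
    n ≤ 2 ^ Fintype.card α := by
  classical
  have : (Finset.range n).card ≤ (Finset.univ : Finset (Finset α)).card := by
    -- For `j < k`, the colour `R j k` lies in the set attached to `k` but not in the one attached
    -- to `j`.
    refine Finset.card_le_card_of_injOn (fun j => (Finset.range j).image fun i => R i j)
      (fun _ _ => Finset.mem_coe.2 (Finset.mem_univ _)) ?_
    have key : ∀ j k, j < k → k < n →
        ((Finset.range j).image fun i => R i j) ≠ (Finset.range k).image fun i => R i k := by
      intro j k hjk hk he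
      have hmem : R j k ∈ (Finset.range k).image fun i => R i k :=
        Finset.mem_image_of_mem (fun i => R i k) (Finset.mem_range.2 hjk)
      rw [← he] at hmem
      obtain ⟨i, hi, hie⟩ := Finset.mem_image.1 hmem
      exact hR i j k (Finset.mem_range.1 hi) hjk hk hie
    intro j hj k hk he
    have hj' : j < n := by simpa using hj
    have hk' : k < n := by simpa using hk
    rcases lt_trichotomy j k with h | h | h
    · exact absurd he (key j k h hk')
    · exact h
    · exact absurd he.symm (key k j h hj')
  simpa using this

/-! ### The lower bound on the size of a suitable family. -/

/-- The string whose ones are at the positions `i` and `j`. -/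
def bitPair (d i j : ℕ) : Fin d → Bool := fun x => decide (x.val = i ∨ x.val = j)

theorem bitPair_comm (d i j : ℕ) : bitPair d i j = bitPair d j i := by
  funext x; simp [bitPair, or_comm]

theorem bitPair_adj {d i j : ℕ} (hj : j < d) (hij : i ≠ j) :
    (hypercube d).Adj (bitPair d i i) (bitPair d i j) := by
  refine ⟨⟨j, hj⟩, ?_, fun y hy => ?_⟩
  · simp [bitPair, hij.symm]
  · by_contra hne
    have : y.val ≠ j := fun h => hne (Fin.ext h)
    simp [bitPair, this] at hy

/-- A lower bound for families that separate all disjoint edges of a hypercube. -/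
theorem hypercube_dim_le_of_isPairwiseSuitable {d : ℕ} {F : Finset (VertexPerm (Fin d → Bool))}
    (hF : IsPairwiseSuitable F (graphEdges (hypercube d))) :
    d ≤ 2 ^ 2 ^ (2 * F.card + 1) := by
  classical
  by_contra! hd
  let g : VertexPerm (Fin d → Bool) → (Fin d → Bool) → ℤ := fun σ v => ((σ v).val : ℤ)
  have hginj : ∀ σ, Function.Injective (g σ) := fun σ v w h => by
    have : (σ v).val = (σ w).val := Int.ofNat_injective h
    exact σ.injective (Fin.ext this)
  have hsingle : ∀ i < d, ∀ j < d, bitPair d i i = bitPair d j j → i = j := by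
    intro i hi j hj h
    have := congrFun h ⟨i, hi⟩
    simpa [bitPair] using this
  obtain ⟨T, hTS, hT, hmono⟩ := exists_common_monotone F (fun σ i => g σ (bitPair d i i))
    (F.card + 1) (Finset.range d) (fun σ _ i hi j hj h =>
      hsingle i (by simpa using hi) j (by simpa using hj) (hginj σ h))
    (by rwa [Finset.card_range, ← add_assoc, ← two_mul])
  -- Reversing a permutation does not change what it separates, so each `σ ∈ F` may be taken
  -- increasing on the singletons.
  have hsign : ∀ σ, ∃ h : (Fin d → Bool) → ℤ,
      (σ ∈ F → StrictMonoOn (fun i => h (bitPair d i i)) T) ∧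
      ∀ A B, Separates σ A B → (∀ a ∈ A, ∀ b ∈ B, h a < h b) ∨ ∀ a ∈ A, ∀ b ∈ B, h b < h a := by
    intro σ
    by_cases hσ : σ ∈ F
    · rcases hmono σ hσ with hm | hm
      · refine ⟨g σ, fun _ => hm, fun A B hAB => hAB.imp (fun h a ha b hb => ?_)
          (fun h a ha b hb => ?_)⟩
        · have := h a ha b hb
          simpa [g] using this
        · have := h b hb a ha
          simpa [g] using this
      · refine ⟨fun v => - g σ v, fun _ i hi j hj hij => neg_lt_neg (hm hi hj hij),
          fun A B hAB => hAB.symm.imp (fun h a ha b hb => ?_) (fun h a ha b hb => ?_)⟩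
        · have := h b hb a ha
          simpa [g] using this
        · have := h a ha b hb
          simpa [g] using this
    · refine ⟨g σ, fun h => absurd h hσ, fun A B hAB => hAB.imp (fun h a ha b hb => ?_)
          (fun h a ha b hb => ?_)⟩
      · have := h a ha b hb
        simpa [g] using this
      · have := h b hb a ha
        simpa [g] using this
  choose h hhm hhs using hsign
  obtain ⟨N, hN⟩ : ∃ N, T.card = N + 1 :=
    ⟨T.card - 1, (Nat.sub_add_cancel (Nat.one_le_of_lt hT)).symm⟩
  let e := T.orderEmbOfFin hN
  let c : ℕ → ℕ := fun i => if hi : i < N + 1 then e ⟨i, hi⟩ else 0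
  have hcT : ∀ i, i < N + 1 → c i ∈ T := fun i hi => by
    simp only [c, dif_pos hi]; exact T.orderEmbOfFin_mem hN _
  have hcd : ∀ i, i < N + 1 → c i < d := fun i hi => Finset.mem_range.1 (hTS (hcT i hi))
  have hclt : ∀ i j, i < j → j < N + 1 → c i < c j := fun i j hij hj => by
    simp only [c, dif_pos hj, dif_pos (hij.trans hj)]
    exact e.strictMono hij
  let u : ℕ → Fin d → Bool := fun i => bitPair d (c i) (c i)
  let s : ℕ → ℕ → Fin d → Bool := fun i j => bitPair d (c i) (c j)
  have hu : ∀ σ ∈ F, ∀ i j, i < j → j < N + 1 → h σ (u i) < h σ (u j) := fun σ hσ i j hij hj =>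
    hhm σ hσ (hcT i (hij.trans hj)) (hcT j hj) (hclt i j hij hj)
  -- The edges `{u (j + 1), s i (j + 1)}` and `{u j, s j (k + 1)}` are disjoint because bit `c (j +
  -- 1)` is one on the first and zero on the second. Since `u j` comes before `u (j + 1)`, the
  -- second edge must come first.
  have key : ∀ i j k, i < j → j < k → k < N → ∃ σ ∈ F,
      h σ (u j) < h σ (s i (j + 1)) ∧ h σ (s j (k + 1)) < h σ (u (j + 1)) := by
    intro i j k hij hjk hk
    have a1 := hclt i j hij (by omega)
    have a2 := hclt j (j + 1) (by omega) (by omega)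
    have a3 := hclt (j + 1) (k + 1) (by omega) (by omega)
    have b1 := hcd (k + 1) (by omega)
    have hdisj : Disjoint ({u (j + 1), s i (j + 1)} : Finset (Fin d → Bool))
        {u j, s j (k + 1)} := by
      have hat : ∀ v w : Fin d → Bool, ∀ x : Fin d, v x = true → w x = false → v ≠ w := by
        rintro v w x hv hw rfl
        simp [hv] at hw
      have hx : c (j + 1) < d := by omega
      rw [Finset.disjoint_left]
      intro v hv hw
      have hv' : v ⟨c (j + 1), hx⟩ = true := by
        rcases Finset.mem_insert.1 hv with rfl | hv
        · simp [u, bitPair]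
        · rw [Finset.mem_singleton.1 hv]; simp [s, bitPair]
      have hw' : v ⟨c (j + 1), hx⟩ = false := by
        rcases Finset.mem_insert.1 hw with rfl | hw
        · simp [u, bitPair, a2.ne']
        · rw [Finset.mem_singleton.1 hw]; simp [s, bitPair, a2.ne', a3.ne]
      simp [hv'] at hw'
    obtain ⟨σ, hσ, hsep⟩ := hF {u (j + 1), s i (j + 1)}
      ⟨_, _, by simpa [s, u, bitPair_comm d (c i)] using
        bitPair_adj (i := c (j + 1)) (hcd i (by omega)) (by omega), rfl⟩
      {u j, s j (k + 1)} ⟨_, _, bitPair_adj b1 (by omega), rfl⟩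
      (fun he => by
        rw [he] at hdisj
        simp at hdisj) hdisj
    refine ⟨σ, hσ, ?_⟩
    have hlt := hu σ hσ j (j + 1) (by omega) (by omega)
    rcases hhs σ _ _ hsep with hh | hh
    · exact absurd (hh (u (j + 1)) (by simp) (u j) (by simp)) hlt.asymm
    · exact ⟨hh _ (by simp) _ (by simp), hh _ (by simp) _ (by simp)⟩
  -- Equal colours at `(i, j)` and `(j, k)` would give `u k < s j (k + 1) < u (j + 1)` under some `h
  -- σ`, although `j + 1 ≤ k`.
  have hle := card_le_of_shift_coloring (α := Set F) N
    (fun i j => {σ : F | h σ (u j) < h σ (s i (j + 1))}) (by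
      intro i j k hij hjk hk he
      obtain ⟨σ, hσ, h1, h2⟩ := key i j k hij hjk hk
      have h3 : (⟨σ, hσ⟩ : F) ∈ {σ : F | h σ (u k) < h σ (s j (k + 1))} := by
        rw [← he]; exact h1
      have h4 : h σ (u k) < h σ (s j (k + 1)) := h3
      rcases (show j + 1 = k ∨ j + 1 < k by omega) with h5 | h5
      · subst h5; exact absurd h2 h4.asymm
      · exact absurd (h4.trans h2) (hu σ hσ (j + 1) k h5 (by omega)).asymm)
  have hcardSet : Fintype.card (Set F) = 2 ^ F.card := by simp
  rw [hcardSet] at hle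
  have : 2 ^ 2 ^ F.card < 2 ^ 2 ^ (F.card + 1) :=
    Nat.pow_lt_pow_right (by norm_num) (Nat.pow_lt_pow_right (by norm_num) (by omega))
  omega

/-! ### Lexicographic orders and Spencer's construction. -/

theorem exists_vertexPerm_lt_iff {V α : Type*} [Fintype V] [LinearOrder α] {f : V → α}
    (hf : Function.Injective f) :
    ∃ σ : VertexPerm V, ∀ v w, σ v < σ w ↔ f v < f w := by
  let : LinearOrder V := LinearOrder.lift' f hf
  exact ⟨(Fintype.orderIsoFinOfCardEq V rfl).symm.toEquiv,
    fun v w => (Fintype.orderIsoFinOfCardEq V rfl).symm.lt_iff_lt⟩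

/-- The lexicographic order of binary strings, reading the positions in the order `ρ`, separates
two edges in directions `i` and `j` if the strings differ at a position that `ρ` places before
`i` and `j`. -/
theorem exists_vertexPerm_lex {V : Type*} [Fintype V] [DecidableEq V] (ρ : VertexPerm V) :
    ∃ σ : VertexPerm (V → Bool), ∀ (i j l : V) (u u' v v' : V → Bool),
      ρ l < ρ i → ρ l < ρ j → u l ≠ v l → (∀ x, x ≠ i → u' x = u x) →
      (∀ x, x ≠ j → v' x = v x) → Separates σ {u, u'} {v, v'} := by
  have hinj : Function.Injective
      (fun v : V → Bool => toLex fun r : Fin (Fintype.card V) => v (ρ.symm r)) := by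
    intro v w h
    funext x
    simpa using congrFun (toLex.injective h) (ρ x)
  obtain ⟨σ, hσ⟩ := exists_vertexPerm_lt_iff hinj
  refine ⟨σ, fun i j l u u' v v' hli hlj hl hu hv => ?_⟩
  have hex : ∃ r, u (ρ.symm r) ≠ v (ρ.symm r) := ⟨ρ l, by simpa using hl⟩
  obtain ⟨r, hr, hmin⟩ := WellFounded.has_min (r := fun a b : Fin (Fintype.card V) => a < b)
    wellFounded_lt {r | u (ρ.symm r) ≠ v (ρ.symm r)} hex
  -- The first difference `r` is read before `i` and `j`, so up to `r` both ends of each edge agree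
  -- and all four comparisons go the same way.
  have hrl : r ≤ ρ l := le_of_not_gt (hmin (ρ l) (by simpa using hl))
  have hagree : ∀ t < r, u (ρ.symm t) = v (ρ.symm t) := fun t ht => by
    by_contra h
    exact hmin t h ht
  have hne : ∀ k t, ρ l < ρ k → t ≤ r → ρ.symm t ≠ k := by
    rintro _ t hk ht rfl
    rw [Equiv.apply_symm_apply] at hk
    exact absurd (ht.trans hrl) (not_le.2 hk)
  have hx : ∀ x ∈ ({u, u'} : Finset (V → Bool)), ∀ t ≤ r, x (ρ.symm t) = u (ρ.symm t) := by
    intro x hx t ht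
    rcases Finset.mem_insert.1 hx with rfl | hx
    · rfl
    · rw [Finset.mem_singleton.1 hx, hu _ (hne i t hli ht)]
  have hy : ∀ y ∈ ({v, v'} : Finset (V → Bool)), ∀ t ≤ r, y (ρ.symm t) = v (ρ.symm t) := by
    intro y hy t ht
    rcases Finset.mem_insert.1 hy with rfl | hy
    · rfl
    · rw [Finset.mem_singleton.1 hy, hv _ (hne j t hlj ht)]
  rcases lt_or_gt_of_ne hr with h | h
  · left
    intro x hx' y hy'
    rw [hσ]
    refine ⟨r, fun t ht => ?_, ?_⟩
    · exact (hx x hx' t ht.le).trans ((hagree t ht).trans (hy y hy' t ht.le).symm)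
    · change x (ρ.symm r) < y (ρ.symm r)
      rwa [hx x hx' r le_rfl, hy y hy' r le_rfl]
  · right
    intro y hy' x hx'
    rw [hσ]
    refine ⟨r, fun t ht => ?_, ?_⟩
    · exact (hy y hy' t ht.le).trans ((hagree t ht).symm.trans (hx x hx' t ht.le).symm)
    · change y (ρ.symm r) < x (ρ.symm r)
      rwa [hx x hx' r le_rfl, hy y hy' r le_rfl]

/-- If every position `l` precedes any two others in one of the orders `ρ p`, then a family of at
most as many permutations separates all disjoint edges of the hypercube. -/
theorem exists_isPairwiseSuitable_hypercube {d : ℕ} {ι : Type*} [Fintype ι]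
    (ρ : ι → VertexPerm (Fin d))
    (hρ : ∀ l i j, l ≠ i → l ≠ j → ∃ p, ρ p l < ρ p i ∧ ρ p l < ρ p j) :
    ∃ F : Finset (VertexPerm (Fin d → Bool)),
      IsPairwiseSuitable F (graphEdges (hypercube d)) ∧ F.card ≤ Fintype.card ι := by
  classical
  choose σ hσ using fun p => exists_vertexPerm_lex (ρ p)
  refine ⟨Finset.univ.image σ, ?_, Finset.card_image_le⟩
  rintro _ ⟨u, u', ⟨i, hi, hi'⟩, rfl⟩ _ ⟨v, v', ⟨j, hj, hj'⟩, rfl⟩ hne hdisj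
  have hu : ∀ x, x ≠ i → u' x = u x := fun x hx => by
    by_contra h
    exact hx (hi' x fun h' => h h'.symm)
  have hv : ∀ x, x ≠ j → v' x = v x := fun x hx => by
    by_contra h
    exact hx (hj' x fun h' => h h'.symm)
  -- Otherwise the edges meet: choose an end `a` of the first agreeing with `v` at `i`, then an end
  -- `b` of the second agreeing with `a` at `j`.
  have hex : ∃ l, l ≠ i ∧ l ≠ j ∧ u l ≠ v l := by
    by_contra! hcon
    have hd1 : ∀ a ∈ ({u, u'} : Finset (Fin d → Bool)), ∀ b ∈ ({v, v'} : Finset (Fin d → Bool)),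
        a ≠ b := fun a ha b hb hab => Finset.disjoint_left.1 hdisj ha (hab ▸ hb)
    have hflip : ∀ a b c : Bool, a ≠ b → c ≠ a → c = b := by decide
    obtain ⟨a, ha, hav, hao⟩ : ∃ a ∈ ({u, u'} : Finset (Fin d → Bool)), a i = v i ∧
        ∀ x, x ≠ i → a x = u x := by
      by_cases h : u i = v i
      · exact ⟨u, by simp, h, fun _ _ => rfl⟩
      · exact ⟨u', by simp, (hflip _ _ _ hi (Ne.symm h)).symm, hu⟩
    obtain ⟨b, hb, hba, hbo⟩ : ∃ b ∈ ({v, v'} : Finset (Fin d → Bool)), b j = a j ∧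
        ∀ x, x ≠ j → b x = v x := by
      by_cases h : v j = a j
      · exact ⟨v, by simp, h, fun _ _ => rfl⟩
      · exact ⟨v', by simp, (hflip _ _ _ hj (Ne.symm h)).symm, hv⟩
    refine hd1 a ha b hb (funext fun x => ?_)
    by_cases hxj : x = j
    · rw [hxj, hba]
    · rw [hbo x hxj]
      by_cases hxi : x = i
      · rw [hxi, hav]
      · rw [hao x hxi, hcon x hxi hxj]
  obtain ⟨l, hli, hlj, hl⟩ := hex
  obtain ⟨p, hp1, hp2⟩ := hρ l i j hli hlj
  exact ⟨σ p, Finset.mem_image_of_mem _ (Finset.mem_univ _),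
    hσ p i j l u u' v v' hp1 hp2 hl hu hv⟩

/-- A large family of pairwise qualitatively independent subsets of a set of `m + 1` elements. -/
theorem exists_qualitatively_independent {m r : ℕ} (h : 2 * r < m) :
    ∃ a : Fin (m.choose r) → Fin (m + 1) → Bool, ∀ n n' b b', (n = n' → b = b') →
      ∃ p, a n p = b ∧ a n' p = b' := by
  classical
  have hcard : Fintype.card (Finset.powersetCard r (Finset.univ : Finset (Fin m))) =
      m.choose r := by simp
  let e := (Fintype.equivFinOfCardEq hcard).symm
  have he : ∀ n, (e n).1.card = r := fun n => (Finset.mem_powersetCard.1 (e n).2).2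
  have hnsub : ∀ n n', n ≠ n' → ∃ x, x ∈ (e n).1 ∧ x ∉ (e n').1 := by
    intro n n' hn
    by_contra! hcon
    exact hn (e.injective (Subtype.ext (Finset.eq_of_subset_of_card_le hcon
      (by rw [he, he]))))
  have hout : ∀ n n', ∃ x, x ∉ (e n).1 ∧ x ∉ (e n').1 := by
    intro n n'
    by_contra! hcon
    have h1 : (Finset.univ : Finset (Fin m)) ⊆ (e n).1 ∪ (e n').1 := fun x _ => by
      by_cases hx : x ∈ (e n).1
      · exact Finset.mem_union_left _ hx
      · exact Finset.mem_union_right _ (hcon x hx)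
    have h2 := (Finset.card_le_card h1).trans (Finset.card_union_le _ _)
    rw [he, he, Finset.card_univ, Fintype.card_fin] at h2
    omega
  -- A point common to all sets gives the pattern true-true; `2 * r < m` gives false-false, and
  -- equal cardinalities give the mixed ones.
  refine ⟨fun n => Fin.cons true fun x => decide (x ∈ (e n).1), fun n n' b b' hb => ?_⟩
  cases b <;> cases b'
  · obtain ⟨x, hx, hx'⟩ := hout n n'
    exact ⟨x.succ, by simp [hx], by simp [hx']⟩
  · obtain ⟨x, hx, hx'⟩ := hnsub n' n fun h => by simpa using hb h.symm
    exact ⟨x.succ, by simp [hx'], by simp [hx]⟩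
  · obtain ⟨x, hx, hx'⟩ := hnsub n n' fun h => by simpa using hb h
    exact ⟨x.succ, by simp [hx], by simp [hx']⟩
  · exact ⟨0, by simp, by simp⟩

/-- Spencer's construction of orders in which every element precedes any two others. -/
theorem exists_scrambling_orders {d m r : ℕ} (h : 2 * r < m) (hd : d ≤ 2 ^ m.choose r) :
    ∃ ρ : Fin (m + 1) → VertexPerm (Fin d), ∀ l i j, l ≠ i → l ≠ j →
      ∃ p, ρ p l < ρ p i ∧ ρ p l < ρ p j := by
  classical
  obtain ⟨a, ha⟩ := exists_qualitatively_independent h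
  obtain ⟨φ⟩ : Nonempty (Fin d ↪ (Fin (m.choose r) → Bool)) :=
    Function.Embedding.nonempty_of_card_le (by simpa using hd)
  -- Order `p` flips the coordinates `n` with `a n p` true. Then `l` precedes `i` when `a n p = φ l
  -- n` at their first difference `n`, and independence meets this demand for `i` and `j` at once.
  have hinj : ∀ p, Function.Injective
      (fun x : Fin d => toLex fun n => xor (φ x n) (a n p)) := by
    intro p x y hxy
    refine φ.injective (funext fun n => ?_)
    have := congrFun (toLex.injective hxy) n
    simpa using this
  choose ρ hρ using fun p => exists_vertexPerm_lt_iff (hinj p)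
  have hdiff : ∀ l i : Fin d, l ≠ i → ∃ n, φ l n ≠ φ i n ∧ ∀ t < n, φ l t = φ i t := by
    intro l i hli
    have hex : ∃ n, φ l n ≠ φ i n := by
      by_contra! hcon
      exact hli (φ.injective (funext hcon))
    obtain ⟨n, hn, hmin⟩ := WellFounded.has_min (r := fun a b : Fin (m.choose r) => a < b)
      wellFounded_lt {n | φ l n ≠ φ i n} hex
    refine ⟨n, hn, fun t ht => ?_⟩
    by_contra hcon
    exact hmin t hcon ht
  refine ⟨ρ, fun l i j hli hlj => ?_⟩
  obtain ⟨n, hn, hnt⟩ := hdiff l i hli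
  obtain ⟨n', hn', hnt'⟩ := hdiff l j hlj
  obtain ⟨p, hp, hp'⟩ := ha n n' (φ l n) (φ l n') (fun h => by rw [h])
  have hbool : ∀ x y z : Bool, x ≠ y → z = x → xor x z < xor y z := by decide
  have hlt : ∀ x n, φ l n ≠ φ x n → (∀ t < n, φ l t = φ x t) → a n p = φ l n →
      ρ p l < ρ p x := by
    intro x n hn hnt hp
    rw [hρ]
    refine ⟨n, fun t ht => ?_, ?_⟩
    · change xor (φ l t) (a t p) = xor (φ x t) (a t p)
      rw [hnt t ht]
    · exact hbool _ _ _ hn hp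
  exact ⟨p, hlt i n hn hnt hp, hlt j n' hn' hnt' hp'⟩

theorem separationDimension_hypercube_le {d m r : ℕ} (h : 2 * r < m)
    (hdm : d ≤ 2 ^ m.choose r) :
    separationDimension (graphEdges (hypercube d)) ≤ m + 1 := by
  obtain ⟨ρ, hρ⟩ := exists_scrambling_orders h hdm
  obtain ⟨F, hF, hcard⟩ := exists_isPairwiseSuitable_hypercube ρ hρ
  rw [Fintype.card_fin] at hcard
  have hle : separationDimension (graphEdges (hypercube d)) ≤ F.card :=
    Nat.sInf_le ⟨F, hF, rfl⟩
  exact hle.trans hcard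

/-- As `sInf ∅ = 0` in `ℕ`, a lower bound needs some suitable family to exist. -/
theorem exists_isPairwiseSuitable_card_eq {d : ℕ} (hd : 3 ≤ d) :
    ∃ F : Finset (VertexPerm (Fin d → Bool)), IsPairwiseSuitable F (graphEdges (hypercube d)) ∧
      F.card = separationDimension (graphEdges (hypercube d)) := by
  obtain ⟨ρ, hρ⟩ := exists_scrambling_orders (d := d) (m := d) (r := 1) (by omega)
    (by rw [Nat.choose_one_right]; exact Nat.lt_two_pow_self.le)
  obtain ⟨F, hF, -⟩ := exists_isPairwiseSuitable_hypercube ρ hρ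
  exact Nat.sInf_mem (s := {k | ∃ F : Finset (VertexPerm (Fin d → Bool)),
    IsPairwiseSuitable F (graphEdges (hypercube d)) ∧ F.card = k}) ⟨_, F, hF, rfl⟩

theorem half_floor_le_separationDimension_hypercube {d : ℕ} (hd : 3 ≤ d) :
    (1 / 2 : ℝ) * (⌊Real.logb 2 (Real.logb 2 ((d : ℝ) - 1))⌋ : ℝ) ≤
      (separationDimension (graphEdges (hypercube d)) : ℝ) := by
  obtain ⟨F, hF, hcard⟩ := exists_isPairwiseSuitable_card_eq hd
  have hle := hypercube_dim_le_of_isPairwiseSuitable hF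
  rw [hcard] at hle
  set k := separationDimension (graphEdges (hypercube d))
  have hd3 : (3 : ℝ) ≤ d := by exact_mod_cast hd
  have h1 : 0 < Real.logb 2 ((d : ℝ) - 1) := Real.logb_pos (by norm_num) (by linarith)
  -- Passing from `d` to `d - 1` makes this strict, so the floor is at most `2 * k`.
  have hlt : Real.logb 2 (Real.logb 2 ((d : ℝ) - 1)) < ((2 * k + 1 : ℤ) : ℝ) := by
    have hdk : (d : ℝ) - 1 < (2 : ℝ) ^ ((2 ^ (2 * k + 1) : ℕ) : ℝ) := by
      rw [Real.rpow_natCast]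
      have : (d : ℝ) ≤ 2 ^ 2 ^ (2 * k + 1) := by exact_mod_cast hle
      linarith
    rw [← Real.logb_lt_iff_lt_rpow (by norm_num) (by linarith)] at hdk
    rw [Real.logb_lt_iff_lt_rpow (by norm_num) h1]
    refine hdk.trans_le (le_of_eq ?_)
    rw [show ((2 * k + 1 : ℤ) : ℝ) = ((2 * k + 1 : ℕ) : ℝ) by push_cast; ring,
      Real.rpow_natCast]
    push_cast
    ring
  have hfl : ⌊Real.logb 2 (Real.logb 2 ((d : ℝ) - 1))⌋ ≤ 2 * (k : ℤ) := by
    have := Int.floor_lt.2 hlt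
    omega
  have : (⌊Real.logb 2 (Real.logb 2 ((d : ℝ) - 1))⌋ : ℝ) ≤ 2 * (k : ℝ) := by exact_mod_cast hfl
  linarith

/-! ### Asymptotics of the upper bound. -/

/-- This is the bound `π / 2` on Wallis's partial products, in terms of the central binomial
coefficient. -/
theorem two_mul_sixteen_pow_le_centralBinom_sq (n : ℕ) :
    2 * (16 : ℝ) ^ n ≤ (n.centralBinom : ℝ) ^ 2 * (2 * n + 1) * Real.pi := by
  have hW := Real.Wallis.W_le n
  have hB : (0 : ℝ) < n.centralBinom := by exact_mod_cast n.centralBinom_pos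
  have hfac : (n.centralBinom : ℝ) * (n.factorial : ℝ) ^ 2 = ((2 * n).factorial : ℝ) := by
    have := Nat.add_choose_mul_factorial_mul_factorial n n
    rw [← two_mul, ← Nat.centralBinom_eq_two_mul_choose] at this
    rw [← this]
    push_cast
    ring
  rw [Real.Wallis.W_eq_factorial_ratio, ← hfac, div_le_iff₀ (by positivity), pow_mul] at hW
  have hpos : (0 : ℝ) < (n.factorial : ℝ) ^ 4 := by positivity
  refine le_of_mul_le_mul_right ?_ hpos
  norm_num at hW
  linarith

/-- For odd `k` the coefficient is `(k - 1) / (k + 1)` times a central one, whence the form; for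
even `k` it is half a central one, and the bound is weakened to match. -/
theorem four_pow_mul_sq_le_choose_sq {k : ℕ} (hk : 2 ≤ k) :
    (4 : ℝ) ^ k * ((k : ℝ) - 1) ^ 2 ≤
      (((k - 1).choose (k / 2 - 1) : ℕ) : ℝ) ^ 2 * (2 * Real.pi * ((k : ℝ) + 1) ^ 3) := by
  have hpi := Real.pi_pos
  obtain ⟨j, hj | hj⟩ : ∃ j, k = 2 * (j + 1) ∨ k = 2 * (j + 1) + 1 := ⟨k / 2 - 1, by omega⟩
  · have h1 : (2 : ℝ) * ((k - 1).choose (k / 2 - 1) : ℕ) = ((j + 1).centralBinom : ℝ) := by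
      rw [show k - 1 = 2 * j + 1 by omega, show k / 2 - 1 = j by omega,
        Nat.centralBinom_eq_two_mul_choose, show 2 * (j + 1) = (2 * j + 1) + 1 by ring,
        Nat.choose_succ_succ, Nat.succ_eq_add_one, Nat.choose_symm_half]
      push_cast
      ring
    have h2 := two_mul_sixteen_pow_le_centralBinom_sq (j + 1)
    rw [← h1] at h2
    have hk' : (k : ℝ) = 2 * ((j : ℝ) + 1) := by rw [hj]; push_cast; ring
    set C : ℝ := (((k - 1).choose (k / 2 - 1) : ℕ) : ℝ)
    have h4 : (4 : ℝ) ^ k = 16 ^ (j + 1) := by rw [hj, pow_mul]; norm_num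
    rw [h4, hk']
    push_cast at h2
    have h5 : (16 : ℝ) ^ (j + 1) ≤ C ^ 2 * (2 * ((j : ℝ) + 1) + 1) * (2 * Real.pi) := by
      linarith
    calc (16 : ℝ) ^ (j + 1) * (2 * ((j : ℝ) + 1) - 1) ^ 2
        ≤ (C ^ 2 * (2 * ((j : ℝ) + 1) + 1) * (2 * Real.pi)) * (2 * ((j : ℝ) + 1) + 1) ^ 2 := by
          have hj0 : (0 : ℝ) ≤ j := j.cast_nonneg
          exact mul_le_mul h5 (pow_le_pow_left₀ (by linarith) (by linarith) 2) (by positivity)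
            (by positivity)
      _ = _ := by ring
  · have h1 : ((k - 1).choose (k / 2 - 1) : ℝ) * ((j : ℝ) + 2) =
        ((j + 1).centralBinom : ℝ) * ((j : ℝ) + 1) := by
      rw [show k - 1 = 2 * (j + 1) by omega, show k / 2 - 1 = j by omega,
        Nat.centralBinom_eq_two_mul_choose]
      have := Nat.choose_succ_right_eq (2 * (j + 1)) j
      rw [show 2 * (j + 1) - j = j + 2 by omega] at this
      exact_mod_cast this.symm
    have h2 := two_mul_sixteen_pow_le_centralBinom_sq (j + 1)
    have hk' : (k : ℝ) = 2 * ((j : ℝ) + 1) + 1 := by rw [hj]; push_cast; ring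
    set C : ℝ := (((k - 1).choose (k / 2 - 1) : ℕ) : ℝ)
    set B : ℝ := ((j + 1).centralBinom : ℝ)
    have h4 : (4 : ℝ) ^ k = 4 * 16 ^ (j + 1) := by rw [hj, pow_succ, pow_mul]; norm_num; ring
    rw [h4, hk']
    push_cast at h2
    have hj0 : (0 : ℝ) ≤ j := j.cast_nonneg
    calc 4 * (16 : ℝ) ^ (j + 1) * (2 * ((j : ℝ) + 1) + 1 - 1) ^ 2
        = (2 * (16 : ℝ) ^ (j + 1)) * (8 * ((j : ℝ) + 1) ^ 2) := by ring
      _ ≤ (B ^ 2 * (2 * ((j : ℝ) + 1) + 1) * Real.pi) * (8 * ((j : ℝ) + 1) ^ 2) :=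
          mul_le_mul_of_nonneg_right h2 (by positivity)
      _ = (B * ((j : ℝ) + 1)) ^ 2 * (8 * Real.pi) * (2 * ((j : ℝ) + 1) + 1) := by ring
      _ ≤ (B * ((j : ℝ) + 1)) ^ 2 * (8 * Real.pi) * (2 * ((j : ℝ) + 2)) :=
          mul_le_mul_of_nonneg_left (by linarith) (by positivity)
      _ = _ := by rw [← h1]; ring

theorem le_logb_choose {k : ℕ} (hk : 2 ≤ k) :
    (k : ℝ) + Real.logb 2 ((k : ℝ) - 1) - 3 / 2 * Real.logb 2 ((k : ℝ) + 1)
      - Real.logb 2 (Real.sqrt (2 * Real.pi)) ≤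
    Real.logb 2 (((k - 1).choose (k / 2 - 1) : ℕ) : ℝ) := by
  have hpi := Real.pi_pos
  have hk2 : (2 : ℝ) ≤ k := by exact_mod_cast hk
  have hC : (0 : ℝ) < (((k - 1).choose (k / 2 - 1) : ℕ) : ℝ) := by
    exact_mod_cast Nat.choose_pos (by omega)
  have hk1 : (0 : ℝ) < (k : ℝ) - 1 := by linarith
  have h := Real.logb_le_logb_of_le (b := 2) (by norm_num) (by positivity)
    (four_pow_mul_sq_le_choose_sq hk)
  rw [Real.logb_mul (by positivity) (by positivity), Real.logb_mul (by positivity) (by positivity),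
    Real.logb_mul (by positivity) (by positivity), Real.logb_pow, Real.logb_pow, Real.logb_pow,
    Real.logb_pow, show (4 : ℝ) = 2 ^ 2 by norm_num, Real.logb_pow,
    Real.logb_self_eq_one (by norm_num)] at h
  have hs : Real.logb 2 (2 * Real.pi) = 2 * Real.logb 2 (Real.sqrt (2 * Real.pi)) := by
    conv_lhs => rw [← Real.sq_sqrt (show 0 ≤ 2 * Real.pi by positivity)]
    rw [Real.logb_pow]
    norm_num
  rw [hs] at h
  push_cast at h
  linarith

theorem tendsto_logb_add_half_logb_sub_logb (c : ℝ) :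
    Tendsto (fun x : ℝ => Real.logb 2 (x + 1 / 2 * Real.logb 2 x + c) - Real.logb 2 x)
      atTop (𝓝 0) := by
  have h1 : Tendsto (fun x : ℝ => Real.log x / x) atTop (𝓝 0) :=
    Real.isLittleO_log_id_atTop.tendsto_div_nhds_zero
  have h2 : Tendsto (fun x : ℝ => 1 + 1 / 2 / Real.log 2 * (Real.log x / x) + c * x⁻¹) atTop
      (𝓝 1) := by
    simpa using ((tendsto_const_nhds (x := (1 : ℝ))).add (h1.const_mul (1 / 2 / Real.log 2))).add
      (tendsto_inv_atTop_zero.const_mul c)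
  have h3 := (Real.continuousAt_logb (b := 2) one_ne_zero).tendsto.comp h2
  rw [Real.logb_one] at h3
  refine h3.congr' ?_
  filter_upwards [eventually_gt_atTop 0, h2.eventually (lt_mem_nhds one_pos)] with x hx hx2
  have he : x + 1 / 2 * Real.logb 2 x + c =
      x * (1 + 1 / 2 / Real.log 2 * (Real.log x / x) + c * x⁻¹) := by
    rw [Real.logb]
    field_simp
  rw [he, Real.logb_mul hx.ne' hx2.ne', Function.comp_apply]
  ring

theorem tendsto_logb_two_atTop : Tendsto (Real.logb 2) atTop atTop :=
  Real.tendsto_logb_atTop (by norm_num)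

theorem eventually_separationDimension_hypercube_le {δ : ℝ} (hδ : 0 < δ) :
    ∀ᶠ d : ℕ in atTop, (separationDimension (graphEdges (hypercube d)) : ℤ) ≤
      ⌈Real.logb 2 (Real.logb 2 (d : ℝ))
        + (1 / 2 : ℝ) * Real.logb 2 (Real.logb 2 (Real.logb 2 (d : ℝ)))
        + Real.logb 2 (Real.sqrt (2 * Real.pi)) + δ⌉ := by
  have hL : Tendsto (fun d : ℕ => Real.logb 2 (Real.logb 2 (d : ℝ))) atTop atTop :=
    tendsto_logb_two_atTop.comp (tendsto_logb_two_atTop.comp tendsto_natCast_atTop_atTop)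
  set c₀ := Real.logb 2 (Real.sqrt (2 * Real.pi)) with hc₀
  have hc₀pos : 0 < c₀ := Real.logb_pos (by norm_num) (by
    rw [Real.lt_sqrt (by norm_num)]
    linarith [Real.pi_gt_three])
  -- The factor `3 / 2` before `logb 2 (k + 1)` in `le_logb_choose` turns this error `2 / 3 * δ`
  -- into exactly `δ`; the `2` covers rounding up and the `+ 1`.
  have hev := (tendsto_logb_add_half_logb_sub_logb (c₀ + δ + 2)).eventually
    (gt_mem_nhds (show (0 : ℝ) < 2 / 3 * δ by positivity))
  filter_upwards [hL.eventually hev, hL.eventually_ge_atTop 2,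
    (tendsto_logb_two_atTop.comp hL).eventually_ge_atTop 2, eventually_ge_atTop 3]
    with d hd hd2 hd3 hd4
  rw [Function.comp_apply] at hd3
  set L := Real.logb 2 (Real.logb 2 (d : ℝ)) with hLdef
  set f := L + 1 / 2 * Real.logb 2 L + c₀ + δ with hf
  have hKge := Int.le_ceil f
  have hKlt := Int.ceil_lt_add_one f
  obtain ⟨k, hk⟩ : ∃ k : ℕ, ⌈f⌉ = k := Int.eq_ofNat_of_zero_le (Int.ceil_nonneg (by linarith))
  rw [hk] at hKge hKlt ⊢
  push_cast at hKge hKlt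
  have hk2 : 2 ≤ k := by
    have : (2 : ℝ) ≤ k := by linarith
    exact_mod_cast this
  have hchoose := le_logb_choose hk2
  have h1 : Real.logb 2 L ≤ Real.logb 2 ((k : ℝ) - 1) :=
    Real.logb_le_logb_of_le (by norm_num) (by linarith) (by linarith)
  have h2 : Real.logb 2 ((k : ℝ) + 1) ≤
      Real.logb 2 (L + 1 / 2 * Real.logb 2 L + (c₀ + δ + 2)) :=
    Real.logb_le_logb_of_le (by norm_num) (by positivity) (by linarith)
  have h3 : L ≤ Real.logb 2 (((k - 1).choose (k / 2 - 1) : ℕ) : ℝ) := by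
    rw [← hc₀] at hchoose
    linarith
  have hdR : (3 : ℝ) ≤ d := by exact_mod_cast hd4
  have hlogd : 0 < Real.logb 2 (d : ℝ) := Real.logb_pos (by norm_num) (by linarith)
  have hC : (0 : ℝ) < (((k - 1).choose (k / 2 - 1) : ℕ) : ℝ) := by
    exact_mod_cast Nat.choose_pos (by omega)
  rw [hLdef, Real.logb_le_logb (by norm_num) hlogd hC,
    Real.logb_le_iff_le_rpow (by norm_num) (by linarith), Real.rpow_natCast] at h3
  have := separationDimension_hypercube_le (d := d) (m := k - 1) (r := k / 2 - 1) (by omega)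
    (by exact_mod_cast h3)
  rw [Nat.sub_add_cancel (by omega)] at this
  exact_mod_cast this

theorem exists_tendsto_zero_le_ceil {a : ℕ → ℤ} {f : ℕ → ℝ}
    (h : ∀ δ > 0, ∀ᶠ d in atTop, a d ≤ ⌈f d + δ⌉) :
    ∃ ε : ℕ → ℝ, Tendsto ε atTop (𝓝 0) ∧ ∀ d, a d ≤ ⌈f d + ε d⌉ := by
  -- `a d ≤ ⌈x⌉` means `a d - 1 < x`: the maximum is the shortfall, and the last term makes the
  -- inequality strict.
  refine ⟨fun d => max 0 ((a d : ℝ) - 1 - f d) + 1 / ((d : ℝ) + 1), ?_, fun d => ?_⟩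
  · have hmax : Tendsto (fun d => max 0 ((a d : ℝ) - 1 - f d)) atTop (𝓝 0) := by
      rw [Metric.tendsto_nhds]
      intro δ hδ
      filter_upwards [h δ hδ] with d hd
      rw [Int.le_ceil_iff] at hd
      rw [Real.dist_eq, sub_zero, abs_of_nonneg (le_max_left _ _)]
      exact max_lt hδ (by linarith)
    simpa using hmax.add tendsto_one_div_add_atTop_nhds_zero_nat
  · rw [Int.le_ceil_iff]
    have h1 := le_max_right 0 ((a d : ℝ) - 1 - f d)
    have h2 : (0 : ℝ) < 1 / ((d : ℝ) + 1) := by positivity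
    linarith

theorem mainTheorem12 :
    (∀ d : ℕ, 3 ≤ d →
      (1 / 2 : ℝ) * (⌊Real.logb 2 (Real.logb 2 ((d : ℝ) - 1))⌋ : ℝ) ≤
        (separationDimension (graphEdges (hypercube d)) : ℝ)) ∧
    ∃ ε : ℕ → ℝ, Tendsto ε atTop (𝓝 0) ∧
      ∀ d : ℕ, 3 ≤ d →
        (separationDimension (graphEdges (hypercube d)) : ℤ) ≤
          ⌈Real.logb 2 (Real.logb 2 (d : ℝ))
            + (1 / 2 : ℝ) * Real.logb 2 (Real.logb 2 (Real.logb 2 (d : ℝ)))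
            + Real.logb 2 (Real.sqrt (2 * Real.pi)) + ε d⌉ := by
  refine ⟨fun d hd => half_floor_le_separationDimension_hypercube hd, ?_⟩
  obtain ⟨ε, hε, hle⟩ := exists_tendsto_zero_le_ceil
    (fun δ hδ => eventually_separationDimension_hypercube_le (δ := δ) hδ)
  exact ⟨ε, hε, fun d _ => hle d⟩
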